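/- Let $q_1,q_2>1$ be integers. For primitive Dirichlet characters $\chi_1,\chi_2$ of conductors $q_1,q_2$ with $\chi_1\chi_2(-1)=1$ and for $\gamma=\begin{pmatrix}a&b\\c&d\end{pmatrix}\in\Gamma_0(q_1q_2)\subset\mathrm{SL}_2(\mathbb{Z})$ with $c\ge 1$, let $$S_{\chi_1,\chi_2}(\gamma)=\sum_{j=1}^{c}\ \sum_{i=1}^{q_1}\overline{\chi_2(j)\chi_1(i)}\,B_1\!\left(\frac{j}{c}\right)B_1\!\left(\frac{i}{q_1}+\frac{aj}{c}\right),$$ where $B_1(x)=0$ if $x\in\mathbb{Z}$ and $B_1(x)=x-\lfloor x\rfloor-\frac12$ otherwise; put $S_{\chi_1,\chi_2}(\gamma)=S_{\chi_1,\chi_2}(-\gamma)$ if $c<0$ and $S_{\chi_1,\chi_2}(\gamma)=0$ if $c=0$. Model of computation. A program is a finite text built from elementary instructions by sequencing, branching and while-loops. It works on finitely many registers holding integers, matrices in $\mathrm{SL}_2(\mathbb{Z})$, and elements of the cyclotomic field $K=\mathbb{Q}(e^{2\pi i/m})$, $m=\mathrm{lcm}(\varphi(q_1),\varphi(q_2))$.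 Each of the following takes one step: loading a constant; addition, subtraction, multiplication, and quotient or remainder of division with remainder of integers; comparing two integers ($=$ or $<$); multiplying two matrices, inverting a matrix, reading an entry of a matrix, forming $\begin{pmatrix}1&k\\0&1\end{pmatrix}$ from an integer $k$; adding or multiplying two elements of $K$, converting an integer to an element of $K$; reading an entry of a finite table of constants (matrices or elements of $K$) contained in the program, at the index given by an integer. Theorem. For fixed $q_1,q_2$, the time complexity of computing $S_{\chi_1,\chi_2}(\gamma)$ as a function of $\gamma$ is $O(\log|c|)$. Precisely: there is a constant $C$, depending only on $q_1$ and $q_2$, such that for all primitive $\chi_1,\chi_2$ of conductors $q_1,q_2$ with $\chi_1\chi_2(-1)=1$ there is a program which, for every input $\gamma=\begin{pmatrix}a&b\\c&d\end{pmatrix}\in\Gamma_0(q_1q_2)$, halts with output $S_{\chi_1,\chi_2}(\gamma)$ after at most $C\log|c|$ steps if $c\neq 0$, and after at most $C$ steps if $c=0$. -/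

import Mathlib

open scoped MatrixGroups IntermediateField

/-! ### The generalized Dedekind sum -/

/-- The first Bernoulli function `B₁` (only its values at rational numbers are needed): it vanishes
at the integers and equals `x - ⌊x⌋ - 1/2` elsewhere. -/
def bernoulliB1 (x : ℚ) : ℚ :=
  if Int.fract x = 0 then 0 else x - ⌊x⌋ - 1 / 2

/-- The generalized Dedekind sum `S_{χ₁,χ₂}(γ)`, with `γ = (a b; c d)`. For `c ≥ 1` this is
`∑_{j=1}^{c} ∑_{i=1}^{q₁} conj (χ₂(j) χ₁(i)) B₁(j/c) B₁(i/q₁ + aj/c)`. It is extended to `c ≤ 0`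
in the way forced by the crossed homomorphism property, `S(-γ) = S(γ)` and `S(γ) = 0` for `c = 0`:
for `c < 0` the summand is that of `(-a, -c)`, since `(-a)j/(-c) = aj/c`, and for `c = 0` the
sum is empty. -/
noncomputable def dedekindSum {q₁ q₂ : ℕ} (χ₁ : DirichletCharacter ℂ q₁)
    (χ₂ : DirichletCharacter ℂ q₂) (γ : SL(2, ℤ)) : ℂ :=
  ∑ j ∈ Finset.Icc 1 (γ 1 0).natAbs, ∑ i ∈ Finset.Icc 1 q₁,
    (starRingEnd ℂ) (χ₂ (j : ZMod q₂) * χ₁ (i : ZMod q₁)) *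
      (bernoulliB1 ((j : ℚ) / ((γ 1 0).natAbs : ℚ)) : ℂ) *
      (bernoulliB1 ((i : ℚ) / (q₁ : ℚ) + (γ 0 0 : ℚ) * (j : ℚ) / (γ 1 0 : ℚ)) : ℂ)

/-- The cyclotomic field `ℚ(ζ_m) ⊆ ℂ`, `ζ_m = exp(2πi/m)`, with `m = lcm(φ(q₁), φ(q₂))`. It contains
the values of all Dirichlet characters modulo `q₁` and modulo `q₂`. -/
noncomputable def dedekindField (q₁ q₂ : ℕ) : IntermediateField ℚ ℂ :=
  ℚ⟮Complex.exp (2 * Real.pi * Complex.I / (Nat.lcm q₁.totient q₂.totient : ℕ))⟯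

/-! ### The machine model

A program works on finitely many registers of three sorts, which hold integers, matrices of
`SL(2, ℤ)` and elements of a ring `K` (a cyclotomic field) respectively. It is a finite text with
finitely many constants; every instruction and every test costs one step. There is no indirect
addressing, except for looking up an entry of a finite table that is written in the program.
-/

/-- Elementary instructions. The first argument is the destination register; all other arguments
of type `ℕ` are source registers. -/
inductive Instr (K : Type) : Type
  | intConst (d : ℕ) (n : ℤ)
  | intAdd (d x y : ℕ)
  | intSub (d x y : ℕ)
  | intMul (d x y : ℕ)
  /-- quotient of the division with remainder (`0` if the divisor is `0`) -/
  | intDiv (d x y : ℕ)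
  /-- remainder of the division with remainder, in `[0, |y|)` if the divisor `y` is not `0` -/
  | intMod (d x y : ℕ)
  /-- read the entry `(i, j)` of the matrix register `x` into the integer register `d` -/
  | matEntry (d x : ℕ) (i j : Fin 2)
  | matConst (d : ℕ) (g : SL(2, ℤ))
  | matMul (d x y : ℕ)
  | matInv (d x : ℕ)
  /-- form the matrix `T ^ k = (1 k; 0 1)`, where `k` is the content of the integer register `x` -/
  | matT (d x : ℕ)
  /-- look up the entry of a finite table whose index is in the integer register `x` -/
  | matTable (d : ℕ) (table : List SL(2, ℤ)) (x : ℕ)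
  | cycConst (d : ℕ) (z : K)
  | cycAdd (d x y : ℕ)
  | cycMul (d x y : ℕ)
  /-- convert the integer in the integer register `x` to an element of `K` -/
  | cycOfInt (d x : ℕ)
  /-- look up the entry of a finite table whose index is in the integer register `x` -/
  | cycTable (d : ℕ) (table : List K) (x : ℕ)

/-- The contents of the registers of the three sorts. -/
structure MachineState (K : Type) : Type where
  int : ℕ → ℤ
  mat : ℕ → SL(2, ℤ)
  cyc : ℕ → K

namespace MachineState

variable {K : Type}

def setInt (s : MachineState K) (d : ℕ) (n : ℤ) : MachineState K :=
  { s with int := Function.update s.int d n }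

def setMat (s : MachineState K) (d : ℕ) (g : SL(2, ℤ)) : MachineState K :=
  { s with mat := Function.update s.mat d g }

def setCyc (s : MachineState K) (d : ℕ) (z : K) : MachineState K :=
  { s with cyc := Function.update s.cyc d z }

/-- The initial state: the input is in the matrix register `0`; all other registers hold `0`, or
the identity matrix. -/
def init [Zero K] (γ : SL(2, ℤ)) : MachineState K where
  int := fun _ => 0
  mat := Function.update (fun _ => 1) 0 γ
  cyc := fun _ => 0

end MachineState

/-- The effect of an elementary instruction. -/
def Instr.apply {K : Type} [Ring K] (s : MachineState K) : Instr K → MachineState K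
  | .intConst d n => s.setInt d n
  | .intAdd d x y => s.setInt d (s.int x + s.int y)
  | .intSub d x y => s.setInt d (s.int x - s.int y)
  | .intMul d x y => s.setInt d (s.int x * s.int y)
  | .intDiv d x y => s.setInt d (s.int x / s.int y)
  | .intMod d x y => s.setInt d (s.int x % s.int y)
  | .matEntry d x i j => s.setInt d (s.mat x i j)
  | .matConst d g => s.setMat d g
  | .matMul d x y => s.setMat d (s.mat x * s.mat y)
  | .matInv d x => s.setMat d (s.mat x)⁻¹
  | .matT d x => s.setMat d (ModularGroup.T ^ s.int x)
  | .matTable d table x => s.setMat d (table.getD (s.int x).toNat 1)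
  | .cycConst d z => s.setCyc d z
  | .cycAdd d x y => s.setCyc d (s.cyc x + s.cyc y)
  | .cycMul d x y => s.setCyc d (s.cyc x * s.cyc y)
  | .cycOfInt d x => s.setCyc d (s.int x : K)
  | .cycTable d table x => s.setCyc d (table.getD (s.int x).toNat 0)

/-- Tests compare two integer registers. -/
inductive MachineTest : Type
  | eq (x y : ℕ)
  | lt (x y : ℕ)

def MachineTest.Holds {K : Type} (s : MachineState K) : MachineTest → Prop
  | .eq x y => s.int x = s.int y
  | .lt x y => s.int x < s.int y

/-- Programs. -/
inductive MachineProgram (K : Type) : Type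
  | instr (i : Instr K)
  | seq (P Q : MachineProgram K)
  | ite (b : MachineTest) (P Q : MachineProgram K)
  | while (b : MachineTest) (P : MachineProgram K)

/-- `P.Runs s t s'`: started in the state `s`, the program `P` halts in the state `s'` after exactly
`t` steps, where each executed instruction and each evaluated test is one step. -/
inductive MachineProgram.Runs {K : Type} [Ring K] :
    MachineProgram K → MachineState K → ℕ → MachineState K → Prop
  | instr (i : Instr K) (s : MachineState K) : Runs (.instr i) s 1 (i.apply s)
  | seq {P Q : MachineProgram K} {s s' s'' : MachineState K} {t t' : ℕ} :
      Runs P s t s' → Runs Q s' t' s'' → Runs (.seq P Q) s (t + t') s''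
  | ite_true {b : MachineTest} {P Q : MachineProgram K} {s s' : MachineState K} {t : ℕ} :
      b.Holds s → Runs P s t s' → Runs (.ite b P Q) s (t + 1) s'
  | ite_false {b : MachineTest} {P Q : MachineProgram K} {s s' : MachineState K} {t : ℕ} :
      ¬ b.Holds s → Runs Q s t s' → Runs (.ite b P Q) s (t + 1) s'
  | while_true {b : MachineTest} {P : MachineProgram K} {s s' s'' : MachineState K} {t t' : ℕ} :
      b.Holds s → Runs P s t s' → Runs (.while b P) s' t' s'' →
        Runs (.while b P) s (t + t' + 1) s''
  | while_false {b : MachineTest} {P : MachineProgram K} {s : MachineState K} :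
      ¬ b.Holds s → Runs (.while b P) s 1 s

/-!
The Dedekind sum is computed by the Euclidean algorithm for the pair `(a, |c| / q₂)`, run once for
every pair of residues `r` modulo `q₂` and `i` modulo `q₁`.

Splitting the sum over `j` into residue classes `r` modulo `q₂` writes `S(γ)` as the sum of
`conj (χ₂(r) χ₁(i))` times the Dedekind–Rademacher sum `s(a, c'; i/q₁, r/q₂)`, where `c' = |c| / q₂`
and the sign of `a` is changed if `c < 0` (`dedekindSum_eq_sum_rademacherSum`). For these sums
Rademacher's reciprocity law holds (`rademacherSum_add_swap`). It follows by summing over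
`u = (j + y)/c`, `v = (k + x)/a` the elementary identity `bernoulliB1_mul_add` between
`B₁(u)`, `B₁(v)`, `B₁(u + v)` and the corresponding values of `B₂`.

With `R(a, c; x, y) = s(a, c; x, y) - (a/2c) B₂(y)`, the reciprocity law for `a % c` becomes
`R(a, c; x, y) = B₁(x') B₁(y) - (n/2) B₂(y) + D B₂(ay + cx) - R(c, a % c; y, x')`, where `n = a / c`
is the quotient of the division with remainder, `x' = x + ny`, and `D` depends only on `a` and `c`
(`reducedSum_step`). The number `ay + cx` modulo `1` is the same for the pairs `(a, c; x, y)` and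
`(c, a % c; y, x')`. If `x` and `y` have denominator `N = q₁q₂`, the first two terms on the right are
integers divided by `12N²`, so `R` is an integer computed by the Euclidean algorithm, divided by
`12N²`, plus a multiple of `B₂(ay + cx)` whose coefficient depends only on `a` and `c`
(`exists_reducedSum_eq`). For `x = i/q₁`, `y = r/q₂` and `q₁ ∣ c'`, neither `B₂(ay + c'x)` nor `B₂(y)`
depends on `i`, so that these terms vanish on summing `conj χ₁` over `i`, and only the integers
remain (`dedekindSum_eq_sum_euclidValue`). In this way the program needs exact arithmetic with
integers only, followed by one multiplication with a constant of the cyclotomic field for each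
pair `(r, i)`.

From the second step on, each division step at least halves the product of the two entries, which
bounds the number of steps by a multiple of `log |c|` (`euclidSteps_le`).
-/

/-! ### The Bernoulli functions -/

theorem bernoulliB1_eq_fract (x : ℚ) :
    bernoulliB1 x = if Int.fract x = 0 then 0 else Int.fract x - 1 / 2 := by
  unfold bernoulliB1 Int.fract
  rfl

/-- The periodic second Bernoulli function `B₂(x) = {x}² - {x} + 1/6`. -/
def bernoulliB2 (x : ℚ) : ℚ := Int.fract x ^ 2 - Int.fract x + 1 / 6

theorem bernoulliB1_periodic : Function.Periodic bernoulliB1 1 := fun x => by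
  simp [bernoulliB1_eq_fract]

theorem bernoulliB2_periodic : Function.Periodic bernoulliB2 1 := fun x => by
  simp [bernoulliB2]

/-- A function of period `1` takes the same value at rationals that differ by an integer. -/
theorem Function.Periodic.eq_of_sub_eq_intCast {f : ℚ → ℚ} (hf : Function.Periodic f 1) {x y : ℚ}
    (n : ℤ) (h : x - y = n) : f x = f y := by
  have h1 := hf.int_mul n y
  rw [mul_one] at h1
  rw [← h1, ← h, add_sub_cancel]

/-- Summing a function of period `1` over the translates of `t` by `ℤ/n`, one may move `t` by
multiples of `1/n`, and so into `[0, 1/n)`. -/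
theorem sum_translates_eq {f : ℚ → ℚ} (hf : Function.Periodic f 1) {n : ℕ} (hn : 0 < n) (t : ℚ) :
    ∑ k ∈ Finset.range n, f (t + k / n) =
      ∑ k ∈ Finset.range n, f ((Int.fract (n * t) + k) / n) := by
  have hn' : (n : ℚ) ≠ 0 := by positivity
  have hg : Function.Periodic (fun t : ℚ => ∑ k ∈ Finset.range n, f (t + k / n)) (1 / n) := by
    intro t
    have h1 := Finset.sum_range_succ (fun k : ℕ => f (t + k / n)) n
    rw [Finset.sum_range_succ', div_self hn', hf t] at h1
    simp only [Nat.cast_zero, zero_div, add_zero, add_left_inj] at h1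
    simp only [← h1]
    refine Finset.sum_congr rfl fun k _ => congrArg f ?_
    push_cast
    ring
  have h2 := hg.int_mul ⌊n * t⌋ (Int.fract (n * t) / n)
  have h3 : Int.fract (n * t) / n + ⌊n * t⌋ * (1 / n) = t := by
    have := Int.fract_add_floor (n * t)
    field_simp
    linarith
  rw [h3] at h2
  refine h2.trans ?_
  exact Finset.sum_congr rfl fun k _ => congrArg f (by ring)

theorem fract_add_div {n k : ℕ} (hk : k < n) {u : ℚ} (h0 : 0 ≤ u) (h1 : u < 1) :
    Int.fract ((u + k) / n) = (u + k) / n := by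
  have hn : (0 : ℚ) < n := by exact_mod_cast (Nat.zero_le k).trans_lt hk
  have hk' : (k : ℚ) + 1 ≤ n := by exact_mod_cast hk
  rw [Int.fract_eq_self]
  refine ⟨by positivity, ?_⟩
  rw [div_lt_one hn]
  linarith

/-- Distribution relation of the first Bernoulli function. -/
theorem sum_bernoulliB1_translates {n : ℕ} (hn : 0 < n) (t : ℚ) :
    ∑ k ∈ Finset.range n, bernoulliB1 (t + k / n) = bernoulliB1 (n * t) := by
  have hn' : (n : ℚ) ≠ 0 := by positivity
  rw [sum_translates_eq bernoulliB1_periodic hn, bernoulliB1_eq_fract (n * t)]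
  have h0 := Int.fract_nonneg (n * t)
  have h1 := Int.fract_lt_one (n * t)
  generalize Int.fract (n * t) = u at h0 h1
  have key : ∀ m : ℕ, ∑ k ∈ Finset.range m, ((u + k) / n - 1 / 2) =
      (m * u + m * (m - 1) / 2) / n - m / 2 := by
    intro m
    induction m with
    | zero => simp
    | succ m ih => rw [Finset.sum_range_succ, ih]; push_cast; ring
  have h2 : ∀ k ∈ Finset.range n, bernoulliB1 ((u + k) / n) =
      ((u + k) / n - 1 / 2) + if k = 0 then (if u = 0 then 1 / 2 else 0) else 0 := by
    intro k hk
    rw [bernoulliB1_eq_fract, fract_add_div (Finset.mem_range.1 hk) h0 h1]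
    have h3 : (u + k) / n = 0 ↔ u = 0 ∧ k = 0 := by
      rw [div_eq_zero_iff, or_iff_left hn', add_eq_zero_iff_of_nonneg h0 (Nat.cast_nonneg k),
        Nat.cast_eq_zero]
    by_cases hu : u = 0 <;> by_cases hk0 : k = 0 <;> simp [h3, hu, hk0, hn']
  rw [Finset.sum_congr rfl h2, Finset.sum_add_distrib, key, Finset.sum_ite_eq' (Finset.range n) 0,
    if_pos (Finset.mem_range.2 hn)]
  split_ifs with hu
  · subst hu; field_simp; ring
  · field_simp; ring

/-- Distribution relation of the second Bernoulli function. -/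
theorem sum_bernoulliB2_translates {n : ℕ} (hn : 0 < n) (t : ℚ) :
    ∑ k ∈ Finset.range n, bernoulliB2 (t + k / n) = bernoulliB2 (n * t) / n := by
  have hn' : (n : ℚ) ≠ 0 := by positivity
  rw [sum_translates_eq bernoulliB2_periodic hn, bernoulliB2]
  have h0 := Int.fract_nonneg (n * t)
  have h1 := Int.fract_lt_one (n * t)
  generalize Int.fract (n * t) = u at h0 h1
  have key : ∀ m : ℕ, ∑ k ∈ Finset.range m, (((u + k) / n) ^ 2 - (u + k) / n + 1 / 6) =
      (m * u ^ 2 + u * m * (m - 1) + (m - 1) * m * (2 * m - 1) / 6) / n ^ 2 -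
        (m * u + m * (m - 1) / 2) / n + m / 6 := by
    intro m
    induction m with
    | zero => simp
    | succ m ih => rw [Finset.sum_range_succ, ih]; push_cast; ring
  have h2 : ∀ k ∈ Finset.range n, bernoulliB2 ((u + k) / n) =
      ((u + k) / n) ^ 2 - (u + k) / n + 1 / 6 := by
    intro k hk
    rw [bernoulliB2, fract_add_div (Finset.mem_range.1 hk) h0 h1]
  rw [Finset.sum_congr rfl h2, key]
  field_simp
  ring

/-- The relation between the Bernoulli functions behind the reciprocity law. -/
theorem bernoulliB1_mul_add {u v : ℚ} (h : ¬(Int.fract u = 0 ∧ Int.fract v = 0)) :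
    bernoulliB1 u * bernoulliB1 v - bernoulliB1 (u + v) * (bernoulliB1 u + bernoulliB1 v) +
      (bernoulliB2 u + bernoulliB2 v + bernoulliB2 (u + v)) / 2 = 0 := by
  have h0 := Int.fract_nonneg u
  have h1 := Int.fract_lt_one u
  have h2 := Int.fract_nonneg v
  have h3 := Int.fract_lt_one v
  have key : Int.fract (u + v) = Int.fract (Int.fract u + Int.fract v) := by
    rw [Int.fract_eq_fract]
    refine ⟨⌊u⌋ + ⌊v⌋, ?_⟩
    have := Int.fract_add_floor u
    have := Int.fract_add_floor v
    push_cast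
    linarith
  simp only [bernoulliB1_eq_fract, bernoulliB2, key]
  generalize Int.fract u = u at *
  generalize Int.fract v = v at *
  have h4 : Int.fract (u + v) = u + v ∨ Int.fract (u + v) = u + v - 1 ∧ 1 ≤ u + v := by
    rcases lt_or_ge (u + v) 1 with h5 | h5
    · exact Or.inl (Int.fract_eq_self.2 ⟨by linarith, h5⟩)
    · refine Or.inr ⟨?_, h5⟩
      rw [← Int.fract_sub_one, Int.fract_eq_self]
      constructor <;> linarith
  rcases h4 with h4 | ⟨h4, h5⟩
  · have h6 : u + v ≠ 0 := fun h7 => h ⟨by linarith, by linarith⟩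
    rw [h4, if_neg h6]
    split_ifs with hu hv hv
    · exact absurd ⟨hu, hv⟩ h
    · subst hu; ring
    · subst hv; ring
    · ring
  · have hu : u ≠ 0 := by intro hu; linarith
    have hv : v ≠ 0 := by intro hv; linarith
    rw [h4, if_neg hu, if_neg hv]
    split_ifs with hw
    · obtain rfl : v = 1 - u := by linarith
      ring
    · ring

/-! ### Dedekind–Rademacher sums and their reciprocity law -/

/-- The Dedekind–Rademacher sum `∑_{j mod c} B₁((j + y)/c) B₁(a(j + y)/c + x)`. -/
def rademacherSum (a : ℤ) (c : ℕ) (x y : ℚ) : ℚ :=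
  ∑ j ∈ Finset.range c, bernoulliB1 ((j + y) / c) * bernoulliB1 (a * ((j + y) / c) + x)

/-- For `a` prime to `c`, multiplication by `a` permutes the translates by `ℤ/c`. -/
theorem sum_mul_translates_eq {f : ℚ → ℚ} (hf : Function.Periodic f 1) {a c : ℕ} (hc : 0 < c)
    (hac : a.Coprime c) (z : ℚ) :
    ∑ j ∈ Finset.range c, f (z + (a * j : ℕ) / c) = ∑ j ∈ Finset.range c, f (z + j / c) := by
  have hc' : (c : ℚ) ≠ 0 := by positivity
  have hmaps : Set.MapsTo (fun j => a * j % c) (Finset.range c) (Finset.range c) := fun j _ => by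
    simpa using Nat.mod_lt _ hc
  have hinj : Set.InjOn (fun j => a * j % c) (Finset.range c) := by
    intro i hi j hj hij
    have h1 : i ≡ j [MOD c] := Nat.ModEq.cancel_left_of_coprime hac.symm hij
    rw [Finset.mem_coe, Finset.mem_range] at hi hj
    rwa [Nat.ModEq, Nat.mod_eq_of_lt hi, Nat.mod_eq_of_lt hj] at h1
  refine Finset.sum_nbij (fun j => a * j % c) hmaps hinj
    (Finset.surjOn_of_injOn_of_card_le _ hmaps hinj le_rfl) fun j _ => ?_
  refine hf.eq_of_sub_eq_intCast (a * j / c : ℕ) ?_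
  have h2 : ((a * j : ℕ) : ℚ) = c * (a * j / c : ℕ) + (a * j % c : ℕ) := by
    exact_mod_cast (Nat.div_add_mod (a * j) c).symm
  rw [h2, Int.cast_natCast]
  field_simp
  ring

/-- Rademacher's reciprocity law, from `bernoulliB1_mul_add` summed over all `u = (j + y)/c` and
`v = (k + x)/a` by means of the distribution relations. -/
theorem rademacherSum_add_swap {a c : ℕ} (ha : 0 < a) (hc : 0 < c) (hac : a.Coprime c) {x y : ℚ}
    (h : ¬(Int.fract x = 0 ∧ Int.fract y = 0)) :
    rademacherSum a c x y + rademacherSum c a y x = bernoulliB1 x * bernoulliB1 y +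
      (a / c * bernoulliB2 y + bernoulliB2 (a * y + c * x) / (a * c) + c / a * bernoulliB2 x) / 2 := by
  have ha' : (a : ℚ) ≠ 0 := by positivity
  have hc' : (c : ℚ) ≠ 0 := by positivity
  set u : ℕ → ℚ := fun j => (j + y) / c with hu
  set v : ℕ → ℚ := fun k => (k + x) / a with hv
  have hcu : ∀ j, c * u j = y + j := fun j => by simp only [hu]; field_simp; ring
  have hav : ∀ k, a * v k = x + k := fun k => by simp only [hv]; field_simp; ring
  have hcy : c * (y / c) = y := by field_simp
  have hax : a * (x / a) = x := by field_simp
  have hsum : ∑ j ∈ Finset.range c, ∑ k ∈ Finset.range a,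
      (bernoulliB1 (u j) * bernoulliB1 (v k) -
        bernoulliB1 (u j + v k) * (bernoulliB1 (u j) + bernoulliB1 (v k)) +
        (bernoulliB2 (u j) + bernoulliB2 (v k) + bernoulliB2 (u j + v k)) / 2) = 0 := by
    refine Finset.sum_eq_zero fun j _ => Finset.sum_eq_zero fun k _ => bernoulliB1_mul_add ?_
    rintro ⟨h1, h2⟩
    rw [Int.fract_eq_zero_iff] at h1 h2
    obtain ⟨m, hm⟩ := h1
    obtain ⟨n, hn⟩ := h2
    refine h ⟨Int.fract_eq_zero_iff.2 ⟨a * n - k, ?_⟩, Int.fract_eq_zero_iff.2 ⟨c * m - j, ?_⟩⟩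
    · push_cast; rw [hn, hav]; ring
    · push_cast; rw [hm, hcu]; ring
  have e1 : ∑ j ∈ Finset.range c, bernoulliB1 (u j) = bernoulliB1 y := by
    have := sum_bernoulliB1_translates hc (y / c)
    rw [hcy] at this
    rw [← this]
    exact Finset.sum_congr rfl fun j _ => congrArg _ (by simp only [hu]; ring)
  have e2 : ∑ k ∈ Finset.range a, bernoulliB1 (v k) = bernoulliB1 x := by
    have := sum_bernoulliB1_translates ha (x / a)
    rw [hax] at this
    rw [← this]
    exact Finset.sum_congr rfl fun j _ => congrArg _ (by simp only [hv]; ring)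
  have e3 : ∑ j ∈ Finset.range c, bernoulliB2 (u j) = bernoulliB2 y / c := by
    have := sum_bernoulliB2_translates hc (y / c)
    rw [hcy] at this
    rw [← this]
    exact Finset.sum_congr rfl fun j _ => congrArg _ (by simp only [hu]; ring)
  have e4 : ∑ k ∈ Finset.range a, bernoulliB2 (v k) = bernoulliB2 x / a := by
    have := sum_bernoulliB2_translates ha (x / a)
    rw [hax] at this
    rw [← this]
    exact Finset.sum_congr rfl fun j _ => congrArg _ (by simp only [hv]; ring)
  have e5 : ∀ j, ∑ k ∈ Finset.range a, bernoulliB1 (u j + v k) = bernoulliB1 (a * u j + x) := by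
    intro j
    have := sum_bernoulliB1_translates ha (u j + x / a)
    rw [mul_add, hax] at this
    rw [← this]
    exact Finset.sum_congr rfl fun j _ => congrArg _ (by simp only [hv]; ring)
  have e6 : ∀ k, ∑ j ∈ Finset.range c, bernoulliB1 (u j + v k) = bernoulliB1 (c * v k + y) := by
    intro k
    have := sum_bernoulliB1_translates hc (v k + y / c)
    rw [mul_add, hcy] at this
    rw [← this]
    exact Finset.sum_congr rfl fun j _ => congrArg _ (by simp only [hu]; ring)
  have e7 : ∑ j ∈ Finset.range c, ∑ k ∈ Finset.range a, bernoulliB2 (u j + v k) =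
      bernoulliB2 (a * y + c * x) / (a * c) := by
    have h1 : ∀ j ∈ Finset.range c, ∑ k ∈ Finset.range a, bernoulliB2 (u j + v k) =
        bernoulliB2 (((a * y + c * x) / c) + (a * j : ℕ) / c) / a := by
      intro j _
      have h2 := sum_bernoulliB2_translates ha (u j + x / a)
      rw [mul_add, hax] at h2
      have h3 : ((a * y + c * x) / c) + (a * j : ℕ) / c = a * u j + x := by
        simp only [hu]; push_cast; field_simp; ring
      rw [h3, ← h2]
      exact Finset.sum_congr rfl fun j _ => congrArg _ (by simp only [hv]; ring)
    rw [Finset.sum_congr rfl h1, ← Finset.sum_div,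
      sum_mul_translates_eq bernoulliB2_periodic hc hac, sum_bernoulliB2_translates hc,
      mul_div_cancel₀ _ hc', div_div, mul_comm (c : ℚ) a]
  have e8 : ∑ j ∈ Finset.range c, (∑ k ∈ Finset.range a, bernoulliB1 (u j + v k)) *
      bernoulliB1 (u j) = rademacherSum a c x y := by
    refine Finset.sum_congr rfl fun j _ => ?_
    rw [e5, mul_comm]
    simp [hu]
  have e9 : ∑ j ∈ Finset.range c, ∑ k ∈ Finset.range a, bernoulliB1 (u j + v k) * bernoulliB1 (v k) =
      rademacherSum c a y x := by
    rw [Finset.sum_comm]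
    refine Finset.sum_congr rfl fun j _ => ?_
    rw [← Finset.sum_mul, e6, mul_comm]
    simp [hv]
  simp only [Finset.sum_add_distrib, Finset.sum_sub_distrib, mul_add, ← Finset.sum_div, e7, e8, e9,
    ← Finset.mul_sum, ← Finset.sum_mul, e1, e2, e4, Finset.sum_const, Finset.card_range,
    nsmul_eq_mul, e3] at hsum
  linear_combination -hsum

/-! ### The reciprocity law along the Euclidean algorithm -/

/-- The Dedekind–Rademacher sum without its part `(a / 2c) B₂(y)`. Removing this part
leaves, up to a multiple of `B₂(ay + cx)`, a number of bounded denominator. -/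
def reducedSum (a : ℤ) (c : ℕ) (x y : ℚ) : ℚ :=
  rademacherSum a c x y - a / c * bernoulliB2 y / 2

theorem rademacherSum_emod {a : ℤ} {c : ℕ} (hc : 0 < c) {x x' y : ℚ} {m : ℤ}
    (hx' : x + (a / c : ℤ) * y - x' = m) :
    rademacherSum a c x y = rademacherSum (a % c) c x' y := by
  have hc' : (c : ℚ) ≠ 0 := by positivity
  refine Finset.sum_congr rfl fun j _ => congrArg _ ?_
  refine bernoulliB1_periodic.eq_of_sub_eq_intCast (a / c * j + m) ?_
  have h1 : (a : ℚ) = c * (a / c : ℤ) + (a % c : ℤ) := by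
    exact_mod_cast (Int.mul_ediv_add_emod a c).symm
  push_cast
  rw [← hx']
  nth_rewrite 1 [h1]
  field_simp
  ring

/-- One division step of the Euclidean algorithm. The last term is `0` if `c` divides `a`, by the
conventions on division by zero and on `reducedSum` of an empty range. -/
theorem reducedSum_step {a : ℤ} {c : ℕ} (hc : 0 < c) (hac : IsCoprime a c) {x x' y : ℚ} {m : ℤ}
    (hx' : x + (a / c : ℤ) * y - x' = m) (h : ¬(Int.fract x = 0 ∧ Int.fract y = 0)) :
    reducedSum a c x y = bernoulliB1 x' * bernoulliB1 y - (a / c : ℤ) * bernoulliB2 y / 2 +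
      1 / (2 * (a % c).toNat * c) * bernoulliB2 (a * y + c * x) -
      reducedSum c (a % c).toNat y x' := by
  have hc' : (c : ℚ) ≠ 0 := by positivity
  have h0 : 0 ≤ a % c := Int.emod_nonneg _ (by positivity)
  obtain ⟨b, hb⟩ := Int.eq_ofNat_of_zero_le h0
  have h1 : a = c * (a / c) + b := by rw [← hb]; exact (Int.mul_ediv_add_emod a c).symm
  have h1' : (a : ℚ) = c * (a / c : ℤ) + b := by exact_mod_cast h1
  have hbc : Nat.Coprime b c := by
    rw [← Nat.isCoprime_iff_coprime]
    rw [h1] at hac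
    exact IsCoprime.of_add_mul_left_left (by rwa [add_comm] at hac)
  have h2 : (a : ℚ) / c = (a / c : ℤ) + b / c := by
    rw [h1']; field_simp
  rw [reducedSum, reducedSum, rademacherSum_emod hc hx', hb, h2, Int.toNat_natCast]
  rcases Nat.eq_zero_or_pos b with hb0 | hb0
  · subst hb0
    obtain rfl : c = 1 := by simpa using hbc
    simp [rademacherSum]
    ring
  · have hb' : (b : ℚ) ≠ 0 := by positivity
    have h3 : ¬(Int.fract x' = 0 ∧ Int.fract y = 0) := by
      rintro ⟨h4, h5⟩
      refine h ⟨?_, h5⟩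
      rw [Int.fract_eq_zero_iff] at h4 h5 ⊢
      obtain ⟨k, hk⟩ := h4
      obtain ⟨l, hl⟩ := h5
      refine ⟨k + m - a / c * l, ?_⟩
      push_cast
      rw [hk, hl, ← hx']
      ring
    have h4 := rademacherSum_add_swap hb0 hc hbc h3
    have h5 : bernoulliB2 (a * y + c * x) = bernoulliB2 (b * y + c * x') := by
      refine bernoulliB2_periodic.eq_of_sub_eq_intCast (c * m) ?_
      push_cast
      rw [h1', ← hx']
      ring
    rw [h5]
    simp only [Int.cast_natCast] at h4 ⊢
    linear_combination h4

/-! ### Integrality of the values -/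

/-- For `0 ≤ X < N`, this integer is `2N B₁(X/N)`; the second factor is `0` for `X = 0` and `1`
otherwise. -/
def bernoulliB1Num (N X : ℤ) : ℤ := (X + X - N) * ((X + N - 1) / N)

/-- For `0 ≤ X < N`, this integer is `6N² B₂(X/N)`. -/
def bernoulliB2Num (N X : ℤ) : ℤ := 6 * (X * (X - N)) + N * N

theorem fract_intCast_div {N X : ℤ} (h0 : 0 ≤ X) (h1 : X < N) :
    Int.fract (X / N : ℚ) = X / N := by
  have hN : (0 : ℚ) < N := by exact_mod_cast h0.trans_lt h1
  have h0' : (0 : ℚ) ≤ X := by exact_mod_cast h0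
  have h1' : (X : ℚ) < N := by exact_mod_cast h1
  rw [Int.fract_eq_self]
  exact ⟨by positivity, by rwa [div_lt_one hN]⟩

theorem bernoulliB1_div {N X : ℤ} (h0 : 0 ≤ X) (h1 : X < N) :
    bernoulliB1 (X / N) = bernoulliB1Num N X / (2 * N) := by
  have hN : (N : ℚ) ≠ 0 := by exact_mod_cast (h0.trans_lt h1).ne'
  rw [bernoulliB1_eq_fract, fract_intCast_div h0 h1, bernoulliB1Num]
  rcases h0.eq_or_lt with hX | hX
  · subst hX
    have : (0 + N - 1) / N = 0 := Int.ediv_eq_zero_of_lt (by omega) (by omega)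
    simp only [this, mul_zero, Int.cast_zero, zero_div, if_true]
  · have h2 : (X + N - 1) / N = 1 := by
      rw [show X + N - 1 = X - 1 + 1 * N by ring, Int.add_mul_ediv_right _ _ (by omega),
        Int.ediv_eq_zero_of_lt (by omega) (by omega), zero_add]
    have h3 : (X : ℚ) ≠ 0 := by exact_mod_cast hX.ne'
    rw [h2, if_neg (div_ne_zero h3 hN)]
    push_cast
    field_simp
    ring

theorem bernoulliB2_div {N X : ℤ} (h0 : 0 ≤ X) (h1 : X < N) :
    bernoulliB2 (X / N) = bernoulliB2Num N X / (6 * N ^ 2) := by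
  have hN : (N : ℚ) ≠ 0 := by exact_mod_cast (h0.trans_lt h1).ne'
  rw [bernoulliB2, fract_intCast_div h0 h1, bernoulliB2Num]
  push_cast
  field_simp

theorem Int.toNat_emod_natCast_lt (a : ℤ) {c : ℕ} (hc : 0 < c) : (a % c).toNat < c := by
  have h1 := Int.emod_nonneg a (Int.natCast_ne_zero.2 hc.ne')
  have h2 := Int.emod_lt_of_pos a (Int.natCast_pos.2 hc)
  omega

/-- The contribution of one division step of the Euclidean algorithm to `12N²` times the reduced
sum. -/
def stepValue (N n X' Y : ℤ) : ℤ :=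
  3 * (bernoulliB1Num N X' * bernoulliB1Num N Y) - n * bernoulliB2Num N Y

/-- The integer which the Euclidean algorithm for `(a, c)` computes from the numerators `X`, `Y` of
`x = X/N`, `y = Y/N`: up to a multiple of `B₂(ay + cx)`, it is `12N²` times `reducedSum a c x y`. -/
def euclidValue (N a : ℤ) (c : ℕ) (X Y : ℤ) : ℤ :=
  if hc : 0 < c then
    stepValue N (a / c) ((X + a / c * Y) % N) Y -
      euclidValue N c (a % c).toNat Y ((X + a / c * Y) % N)
  else 0
termination_by c
decreasing_by exact Int.toNat_emod_natCast_lt a hc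

theorem euclidValue_of_pos (N a : ℤ) {c : ℕ} (hc : 0 < c) (X Y : ℤ) :
    euclidValue N a c X Y = stepValue N (a / c) ((X + a / c * Y) % N) Y -
      euclidValue N c (a % c).toNat Y ((X + a / c * Y) % N) := by
  rw [euclidValue, dif_pos hc]

/-- The number of division steps of the Euclidean algorithm for `(a, c)`. -/
def euclidSteps (a : ℤ) (c : ℕ) : ℕ :=
  if hc : 0 < c then euclidSteps c (a % c).toNat + 1 else 0
termination_by c
decreasing_by exact Int.toNat_emod_natCast_lt a hc

/-- The coefficient `D` does not depend on `X` and `Y`, since `ay + cx` modulo `1` is unchanged by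
the steps of the Euclidean algorithm. -/
theorem exists_reducedSum_eq (N : ℤ) (c : ℕ) : ∀ a : ℤ, IsCoprime a c → ∃ D : ℚ,
    ∀ X Y : ℤ, 0 ≤ X → X < N → 0 ≤ Y → Y < N → ¬(X = 0 ∧ Y = 0) →
      reducedSum a c (X / N) (Y / N) = euclidValue N a c X Y / (12 * N ^ 2) +
        D * bernoulliB2 (a * (Y / N) + c * (X / N)) := by
  induction c using Nat.strong_induction_on with
  | _ c ih =>
  intro a hac
  rcases Nat.eq_zero_or_pos c with rfl | hc
  · refine ⟨0, fun X Y _ _ _ _ _ => ?_⟩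
    rw [euclidValue, dif_neg (lt_irrefl 0)]
    simp [reducedSum, rademacherSum]
  have hb : ((a % c).toNat : ℤ) = a % c :=
    Int.toNat_of_nonneg (Int.emod_nonneg a (Int.natCast_ne_zero.2 hc.ne'))
  have hbc : IsCoprime (c : ℤ) (a % c).toNat := by
    rw [hb]
    have h1 := Int.mul_ediv_add_emod a c
    rw [← h1] at hac
    exact (IsCoprime.of_add_mul_left_left (by rwa [add_comm] at hac)).symm
  obtain ⟨D, hD⟩ := ih _ (Int.toNat_emod_natCast_lt a hc) c hbc
  refine ⟨1 / (2 * (a % c).toNat * c) - D, fun X Y hX0 hX1 hY0 hY1 hXY => ?_⟩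
  have hN : (N : ℚ) ≠ 0 := by exact_mod_cast (hX0.trans_lt hX1).ne'
  have hN0 : 0 < N := hX0.trans_lt hX1
  set n := a / c with hn
  set X' := (X + n * Y) % N with hX'
  have h0 : 0 ≤ X' := Int.emod_nonneg _ hN0.ne'
  have h1 : X' < N := Int.emod_lt_of_pos _ hN0
  have h2 : (X : ℚ) + n * Y - X' = N * ((X + n * Y) / N : ℤ) := by
    have := Int.mul_ediv_add_emod (X + n * Y) N
    rw [sub_eq_iff_eq_add]
    exact_mod_cast this.symm
  have hx' : (X / N : ℚ) + n * (Y / N) - X' / N = ((X + n * Y) / N : ℤ) := by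
    field_simp
    linarith
  have h3 : ¬(Y = 0 ∧ X' = 0) := by
    rintro ⟨hY, hX0'⟩
    rw [hX', hY, mul_zero, add_zero, Int.emod_eq_of_lt hX0 hX1] at hX0'
    exact hXY ⟨hX0', hY⟩
  have h4 : ¬(Int.fract (X / N : ℚ) = 0 ∧ Int.fract (Y / N : ℚ) = 0) := by
    rw [fract_intCast_div hX0 hX1, fract_intCast_div hY0 hY1]
    simpa [hN] using hXY
  have h5 : bernoulliB2 ((c : ℤ) * (X' / N) + (a % c).toNat * (Y / N)) =
      bernoulliB2 (a * (Y / N) + c * (X / N)) := by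
    refine bernoulliB2_periodic.eq_of_sub_eq_intCast (-(c * ((X + n * Y) / N))) ?_
    have h6 : (a : ℚ) = c * n + (a % c).toNat := by
      have := (Int.mul_ediv_add_emod a c).symm
      rw [← hb] at this
      exact_mod_cast this
    rw [h6]
    push_cast at hx' ⊢
    rw [← hx']
    ring
  rw [reducedSum_step hc hac hx' h4, hD Y X' hY0 hY1 h0 h1 h3, h5, bernoulliB1_div h0 h1,
    bernoulliB1_div hY0 hY1, bernoulliB2_div hY0 hY1, euclidValue_of_pos N a hc, stepValue]
  push_cast
  field_simp
  ring

/-! ### The number of division steps -/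

/-- If `c < a`, then `a c` is at least halved by a division step. -/
theorem euclidSteps_le_of_lt (c : ℕ) : ∀ a : ℕ, c < a → euclidSteps a c ≤ Nat.log 2 (a * c) + 1 := by
  induction c using Nat.strong_induction_on with
  | _ c ih =>
  intro a hca
  rw [euclidSteps]
  split_ifs with hc
  · have h1 := Int.toNat_emod_natCast_lt a hc
    have h2 := ih _ h1 c h1
    have h3 : ((a : ℤ) % c).toNat = a % c := rfl
    rw [h3] at h1 h2 ⊢
    rcases Nat.eq_zero_or_pos (a % c) with h0 | h0
    · rw [h0, euclidSteps, dif_neg (lt_irrefl 0)]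
      omega
    · have h4 : 2 * (a % c) ≤ a := by
        have := Nat.div_add_mod a c
        have : 1 ≤ a / c := Nat.div_pos hca.le hc
        nlinarith
      have h5 : c * (a % c) * 2 ≤ a * c := by nlinarith
      have h6 := Nat.log_mono_right (b := 2) h5
      rw [Nat.log_mul_base one_lt_two (by positivity)] at h6
      omega
  · omega

theorem euclidSteps_le (a : ℤ) (c : ℕ) : euclidSteps a c ≤ Nat.log 2 (c * c) + 2 := by
  rw [euclidSteps]
  split_ifs with hc
  · have h1 := Int.toNat_emod_natCast_lt a hc
    have h2 := euclidSteps_le_of_lt _ c h1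
    have h3 := Nat.log_mono_right (b := 2) (Nat.mul_le_mul_left c h1.le)
    omega
  · omega

/-! ### The program -/

namespace MachineProgram

variable {K : Type}

/-- The program that executes the instructions `i :: l` in order. -/
def block (i : Instr K) : List (Instr K) → MachineProgram K
  | [] => .instr i
  | j :: l => .seq (.instr i) (block j l)

theorem runs_block [Ring K] (i : Instr K) (l : List (Instr K)) (s : MachineState K) :
    (block i l).Runs s (l.length + 1) ((i :: l).foldl Instr.apply s) := by
  induction l generalizing i s with
  | nil => exact .instr i s
  | cons j l ih =>
    rw [List.length_cons, add_comm]
    exact .seq (.instr i s) (ih j (i.apply s))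

/-- The program that executes the programs of the list in order. -/
def sequence : List (MachineProgram K) → MachineProgram K
  | [] => .instr (.intConst 0 0)
  | P :: l => .seq P (sequence l)

/-! The integer registers: `0` and `1` hold the pair `(a, c)` of the Euclidean algorithm, `2` and `3`
the numerators `X`, `Y`, `4` the accumulated value, `5` a sign, and `9`, …, `13` the constants
`N, 0, 1, 6, 3`. The registers `6`, `7`, `8`, `14` are for intermediate results,
and so is `0` once `a` has been replaced by the remainder in `14`. -/

/-- The integer registers in the course of the Euclidean algorithm. -/
structure EuclidState (s : MachineState K) (N a c X Y v σ : ℤ) : Prop where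
  a : s.int 0 = a
  c : s.int 1 = c
  X : s.int 2 = X
  Y : s.int 3 = Y
  v : s.int 4 = v
  σ : s.int 5 = σ
  N : s.int 9 = N
  zero : s.int 10 = 0
  one : s.int 11 = 1
  six : s.int 12 = 6
  three : s.int 13 = 3

/-- The remainder (in register `14`) and the new `X`, after the quotient has been put into
register `6`. -/
def divisionCode : List (Instr K) :=
  [.intMod 14 0 1, .intMul 7 6 3, .intAdd 2 2 7, .intMod 2 2 9]

/-- The code for `stepValue`. -/
def valueCode : List (Instr K) :=
  [.intSub 7 3 9, .intMul 7 3 7, .intMul 7 12 7, .intMul 8 9 9, .intAdd 7 7 8, .intMul 6 6 7,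
    .intAdd 7 3 3, .intSub 7 7 9, .intAdd 8 3 9, .intSub 8 8 11, .intDiv 8 8 9, .intMul 7 7 8,
    .intAdd 0 2 2, .intSub 0 0 9, .intAdd 8 2 9, .intSub 8 8 11, .intDiv 8 8 9, .intMul 0 0 8,
    .intMul 7 0 7, .intMul 7 13 7, .intSub 7 7 6]

/-- The code that updates the accumulator and the sign and exchanges the pairs. -/
def swapCode : List (Instr K) :=
  [.intMul 7 5 7, .intAdd 4 4 7, .intSub 5 10 5, .intAdd 0 1 10, .intAdd 1 14 10, .intAdd 6 2 10,
    .intAdd 2 3 10, .intAdd 3 6 10]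

/-- One division step of the Euclidean algorithm. -/
def euclidBody : MachineProgram K :=
  block (.intDiv 6 0 1) (divisionCode ++ valueCode ++ swapCode)

def euclidLoop : MachineProgram K := .while (.lt 10 1) euclidBody

variable [Ring K]

theorem runs_euclidBody {s : MachineState K} {N a c X Y v σ : ℤ}
    (hs : EuclidState s N a c X Y v σ) :
    ∃ s', euclidBody.Runs s 34 s' ∧
      EuclidState s' N c (a % c) Y ((X + a / c * Y) % N)
        (v + σ * stepValue N (a / c) ((X + a / c * Y) % N) Y) (-σ) ∧
      s'.mat = s.mat ∧ s'.cyc = s.cyc := by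
  refine ⟨_, runs_block _ _ s, ?_, ?_, ?_⟩
  · obtain ⟨h0, h1, h2, h3, h4, h5, h9, h10, h11, h12, h13⟩ := hs
    constructor <;>
      simp [divisionCode, valueCode, swapCode, Instr.apply, MachineState.setInt, h0, h1, h2, h3, h4, h5, h9, h10,
        h11, h12, h13, stepValue, bernoulliB1Num, bernoulliB2Num]
  · rfl
  · rfl

theorem runs_euclidLoop (N : ℤ) (c : ℕ) : ∀ (s : MachineState K) (a X Y v σ : ℤ),
    EuclidState s N a c X Y v σ →
    ∃ s', euclidLoop.Runs s (35 * euclidSteps a c + 1) s' ∧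
      s'.int 4 = v + σ * euclidValue N a c X Y ∧ s'.mat = s.mat ∧ s'.cyc = s.cyc := by
  induction c using Nat.strong_induction_on with
  | _ c ih =>
  intro s a X Y v σ hs
  rw [euclidValue, euclidSteps]
  split_ifs with hc
  · obtain ⟨s₁, hrun₁, hs₁, hm₁, hz₁⟩ := runs_euclidBody hs
    rw [← Int.toNat_of_nonneg (Int.emod_nonneg a (Int.natCast_ne_zero.2 hc.ne'))] at hs₁
    obtain ⟨s₂, hrun₂, hv₂, hm₂, hz₂⟩ := ih _ (Int.toNat_emod_natCast_lt a hc) _ _ _ _ _ _ hs₁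
    refine ⟨s₂, ?_, ?_, hm₂.trans hm₁, hz₂.trans hz₁⟩
    · have hb : (MachineTest.lt 10 1).Holds s := by
        simpa [MachineTest.Holds, hs.zero, hs.c] using hc
      rw [show 35 * (euclidSteps c (a % c).toNat + 1) + 1 =
        34 + (35 * euclidSteps c (a % c).toNat + 1) + 1 by ring]
      exact .while_true hb hrun₁ hrun₂
    · rw [hv₂]; ring
  · refine ⟨s, .while_false ?_, by simp [hs.v], rfl, rfl⟩
    simpa [MachineTest.Holds, hs.zero, hs.c] using hc

/-- The initialization: `(a, c)` is read from the matrix register `0`. -/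
def initCode (N X Y : ℤ) : List (Instr K) :=
  [.matEntry 1 0 1 0, .intConst 2 X, .intConst 3 Y, .intConst 4 0, .intConst 5 1, .intConst 9 N,
    .intConst 10 0, .intConst 11 1, .intConst 12 6, .intConst 13 3]

/-- Replace `(a, c)` by `(-a, -c)` if `c < 0`. The instruction in the other branch has no effect, as
register `10` holds `0`. -/
def normalizeSign : MachineProgram K :=
  .ite (.lt 1 10) (block (.intSub 0 10 0) [.intSub 1 10 1]) (.instr (.intConst 10 0))

/-- Multiply the accumulated value by `w` and add the result to the output register. -/
def outputCode (w : K) : List (Instr K) := [.cycConst 2 w, .cycMul 1 1 2, .cycAdd 0 0 1]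

/-- The program which adds `w * euclidValue N a (|c| / q) X Y` to the output register, where
`(a, c)` is the first column of the input matrix, up to sign. -/
def termProgram (N q X Y : ℤ) (w : K) : MachineProgram K :=
  .seq (block (.matEntry 0 0 0 0) (initCode N X Y)) <| .seq normalizeSign <|
    .seq (block (.intConst 8 q) [.intDiv 1 1 8]) <| .seq euclidLoop <|
      block (.cycOfInt 1 4) (outputCode w)

theorem runs_termProgram (N : ℤ) (q : ℕ) (X Y : ℤ) (w : K) (s : MachineState K) :
    ∃ t s', (termProgram N q X Y w).Runs s t s' ∧ s'.mat = s.mat ∧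
      s'.cyc 0 = s.cyc 0 + euclidValue N
        (if s.mat 0 1 0 < 0 then -s.mat 0 0 0 else s.mat 0 0 0) ((s.mat 0 1 0).natAbs / q) X Y * w ∧
      t ≤ 35 * (Nat.log 2 ((s.mat 0 1 0).natAbs * (s.mat 0 1 0).natAbs) + 3) := by
  set a' := if s.mat 0 1 0 < 0 then -s.mat 0 0 0 else s.mat 0 0 0 with ha'
  set n := (s.mat 0 1 0).natAbs with hn
  obtain ⟨s₁, hrun₁, hs₁, hm₁, hz₁⟩ : ∃ s₁ : MachineState K,
      (block (.matEntry 0 0 0 0) (initCode N X Y)).Runs s 11 s₁ ∧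
      EuclidState s₁ N (s.mat 0 0 0) (s.mat 0 1 0) X Y 0 1 ∧ s₁.mat = s.mat ∧ s₁.cyc = s.cyc := by
    refine ⟨_, runs_block _ _ s, ?_, rfl, rfl⟩
    constructor <;> simp [initCode, Instr.apply, MachineState.setInt]
  obtain ⟨t₂, s₂, hrun₂, ht₂, hs₂, hm₂, hz₂⟩ : ∃ (t₂ : ℕ) (s₂ : MachineState K),
      normalizeSign.Runs s₁ t₂ s₂ ∧ t₂ ≤ 3 ∧ EuclidState s₂ N a' n X Y 0 1 ∧
        s₂.mat = s.mat ∧ s₂.cyc = s.cyc := by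
    have htest : (MachineTest.lt 1 10).Holds s₁ ↔ s.mat 0 1 0 < 0 := by
      simp [MachineTest.Holds, hs₁.c, hs₁.zero]
    obtain ⟨h0, h1, h2, h3, h4, h5, h9, h10, h11, h12, h13⟩ := hs₁
    by_cases hc : s.mat 0 1 0 < 0
    · refine ⟨3, _, .ite_true (htest.2 hc) (runs_block _ _ s₁), le_rfl, ?_, hm₁, hz₁⟩
      have hn' : (n : ℤ) = -s.mat 0 1 0 := by omega
      rw [ha', if_pos hc, hn']
      constructor <;> simp [Instr.apply, MachineState.setInt, *]
    · refine ⟨2, _, .ite_false (mt htest.1 hc) (.instr _ s₁), by omega, ?_, hm₁, hz₁⟩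
      have hn' : (n : ℤ) = s.mat 0 1 0 := by omega
      rw [ha', if_neg hc, hn']
      constructor <;> simp [Instr.apply, MachineState.setInt, *]
  obtain ⟨s₃, hrun₃, hs₃, hm₃, hz₃⟩ : ∃ s₃ : MachineState K,
      (block (.intConst 8 q) [.intDiv 1 1 8]).Runs s₂ 2 s₃ ∧
      EuclidState s₃ N a' (n / q : ℕ) X Y 0 1 ∧ s₃.mat = s.mat ∧ s₃.cyc = s.cyc := by
    refine ⟨_, runs_block _ _ s₂, ?_, hm₂, hz₂⟩
    obtain ⟨h0, h1, h2, h3, h4, h5, h9, h10, h11, h12, h13⟩ := hs₂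
    constructor <;> simp [Instr.apply, MachineState.setInt, *]
  obtain ⟨s₄, hrun₄, hv₄, hm₄, hz₄⟩ := runs_euclidLoop N _ s₃ _ _ _ _ _ hs₃
  refine ⟨_, _, .seq hrun₁ (.seq hrun₂ (.seq hrun₃ (.seq hrun₄ (runs_block _ _ s₄)))),
    hm₄.trans hm₃, ?_, ?_⟩
  · simp [outputCode, Instr.apply, MachineState.setCyc, hv₄, hz₄, hz₃]
  · have h1 := euclidSteps_le a' (n / q)
    have h2 := Nat.log_mono_right (b := 2) (Nat.mul_self_le_mul_self (Nat.div_le_self n q))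
    simp only [outputCode, List.length_cons, List.length_nil]
    omega

/-- Programs that leave the input matrix unchanged and add a value depending on it to the output
register are executed in sequence. -/
theorem runs_sequence {ι : Type*} (P : ι → MachineProgram K) (f : ι → K) (γ : SL(2, ℤ)) (B : ℕ)
    (hP : ∀ i (s : MachineState K), s.mat 0 = γ → ∃ t s', (P i).Runs s t s' ∧ s'.mat = s.mat ∧
      s'.cyc 0 = s.cyc 0 + f i ∧ t ≤ B) (l : List ι) :
    ∀ s : MachineState K, s.mat 0 = γ → ∃ t s', (sequence (l.map P)).Runs s t s' ∧
      s'.cyc 0 = s.cyc 0 + (l.map f).sum ∧ t ≤ l.length * B + 1 := by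
  induction l with
  | nil => exact fun s _ => ⟨1, _, .instr _ s, by simp [Instr.apply, MachineState.setInt], by simp⟩
  | cons i l ih =>
    intro s hs
    obtain ⟨t, s', hrun, hm, hz, ht⟩ := hP i s hs
    obtain ⟨t', s'', hrun', hz', ht'⟩ := ih s' (by rw [hm, hs])
    refine ⟨t + t', s'', .seq hrun hrun', ?_, ?_⟩
    · rw [hz', hz, List.map_cons, List.sum_cons, add_assoc]
    · rw [List.length_cons]; linarith

end MachineProgram

/-! ### Sums over residue classes and over characters -/

theorem sum_Icc_one_eq_sum_range {M : Type*} [AddCommGroup M] (f : ℕ → M) (n : ℕ)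
    (h : f n = f 0) : ∑ j ∈ Finset.Icc 1 n, f j = ∑ j ∈ Finset.range n, f j := by
  have h1 : ∑ j ∈ Finset.Icc 1 n, f j = ∑ j ∈ Finset.range n, f (j + 1) := by
    rw [← Finset.Ico_add_one_right_eq_Icc, Finset.sum_Ico_eq_sum_range]
    simp [add_comm]
  have h2 := Finset.sum_range_succ f n
  rw [Finset.sum_range_succ', h] at h2
  rw [h1]
  exact add_right_cancel h2

theorem sum_range_mul_eq {M : Type*} [AddCommMonoid M] (f : ℕ → M) (m n : ℕ) :
    ∑ j ∈ Finset.range (m * n), f j =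
      ∑ r ∈ Finset.range m, ∑ k ∈ Finset.range n, f (m * k + r) := by
  induction n with
  | zero => simp
  | succ n ih =>
    rw [Nat.mul_succ, Finset.sum_range_add, ih, ← Finset.sum_add_distrib]
    exact Finset.sum_congr rfl fun r _ => (Finset.sum_range_succ _ _).symm

namespace DirichletCharacter

theorem sum_range_eq_zero {q : ℕ} (hq : 1 < q) {χ : DirichletCharacter ℂ q}
    (hχ : χ.IsPrimitive) : ∑ i ∈ Finset.range q, χ (i : ZMod q) = 0 := by
  have : NeZero q := ⟨by omega⟩
  have h1 : χ ≠ 1 := by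
    rintro rfl
    rw [isPrimitive_def, conductor_one] at hχ
    omega
  rw [← MulChar.sum_eq_zero_of_ne_one h1]
  exact Finset.sum_nbij' (fun i => (i : ZMod q)) ZMod.val (fun _ _ => Finset.mem_univ _)
    (fun a _ => Finset.mem_range.2 a.val_lt)
    (fun i hi => ZMod.val_cast_of_lt (Finset.mem_range.1 hi)) (fun a _ => ZMod.natCast_zmod_val a)
    fun _ _ => rfl

theorem natCast_zero_eq {q : ℕ} (hq : 1 < q) (χ : DirichletCharacter ℂ q) :
    χ ((0 : ℕ) : ZMod q) = 0 := by
  have : Nontrivial (ZMod q) := ZMod.nontrivial_iff.2 hq.ne'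
  exact χ.map_nonunit (by simp)

theorem pow_totient_eq_one {q : ℕ} (χ : DirichletCharacter ℂ q) {a : ZMod q} (ha : IsUnit a) :
    χ a ^ q.totient = 1 := by
  obtain ⟨u, rfl⟩ := ha
  rw [← map_pow, ← Units.val_pow_eq_pow_val, ZMod.pow_totient, Units.val_one, map_one]

end DirichletCharacter

/-! ### The values of the characters lie in the cyclotomic field -/

theorem mem_dedekindField_of_pow_eq_one {q₁ q₂ : ℕ} (h₁ : 0 < q₁) (h₂ : 0 < q₂) {z : ℂ}
    (hz : z ^ Nat.lcm q₁.totient q₂.totient = 1) : z ∈ dedekindField q₁ q₂ := by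
  have hm : Nat.lcm q₁.totient q₂.totient ≠ 0 :=
    Nat.lcm_ne_zero (Nat.totient_pos.2 h₁).ne' (Nat.totient_pos.2 h₂).ne'
  have : NeZero (Nat.lcm q₁.totient q₂.totient) := ⟨hm⟩
  obtain ⟨k, -, rfl⟩ := (Complex.isPrimitiveRoot_exp _ hm).eq_pow_of_pow_eq_one hz
  exact pow_mem (IntermediateField.mem_adjoin_simple_self ℚ _) k

theorem star_mul_mem_dedekindField {q₁ q₂ : ℕ} (h₁ : 0 < q₁) (h₂ : 0 < q₂)
    (χ₁ : DirichletCharacter ℂ q₁) (χ₂ : DirichletCharacter ℂ q₂) (a : ZMod q₁) (b : ZMod q₂) :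
    (starRingEnd ℂ) (χ₂ b * χ₁ a) ∈ dedekindField q₁ q₂ := by
  by_cases ha : IsUnit a
  · by_cases hb : IsUnit b
    · apply mem_dedekindField_of_pow_eq_one h₁ h₂
      obtain ⟨m, hm⟩ := Nat.dvd_lcm_left q₁.totient q₂.totient
      obtain ⟨n, hn⟩ := Nat.dvd_lcm_right q₁.totient q₂.totient
      rw [← map_pow, mul_pow]
      nth_rewrite 2 [hm]
      rw [hn, pow_mul, pow_mul, χ₁.pow_totient_eq_one ha, χ₂.pow_totient_eq_one hb]
      simp
    · simp [χ₂.map_nonunit hb]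
  · simp [χ₁.map_nonunit ha]

/-! ### The Dedekind sum through the Euclidean algorithm -/

/-- Splitting the sum over `j` into residue classes modulo `q₂` expresses the Dedekind sum through
Dedekind–Rademacher sums. -/
theorem dedekindSum_eq_sum_rademacherSum {q₁ q₂ : ℕ} (hq₁ : 1 < q₁) (hq₂ : 1 < q₂)
    (χ₁ : DirichletCharacter ℂ q₁) (χ₂ : DirichletCharacter ℂ q₂) {γ : SL(2, ℤ)} {c : ℕ} {a : ℤ}
    (hc : (γ 1 0).natAbs = q₂ * c) (ha : a = if γ 1 0 < 0 then -γ 0 0 else γ 0 0) :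
    dedekindSum χ₁ χ₂ γ = ∑ r ∈ Finset.range q₂, ∑ i ∈ Finset.range q₁,
      (starRingEnd ℂ) (χ₂ (r : ZMod q₂) * χ₁ (i : ZMod q₁)) *
        (rademacherSum a c (i / q₁) (r / q₂) : ℂ) := by
  have hq₂' : (q₂ : ℚ) ≠ 0 := by positivity
  have hslope : ∀ j : ℕ, (γ 0 0 : ℚ) * j / (γ 1 0 : ℚ) = a * (j / ((γ 1 0).natAbs : ℚ)) := by
    intro j
    rw [Nat.cast_natAbs, ha]
    split_ifs with h
    · rw [abs_of_neg h]
      push_cast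
      rw [div_neg, neg_mul_neg, mul_div_assoc]
    · rw [abs_of_nonneg (not_lt.1 h), mul_div_assoc]
  have hi : ∀ j : ℕ, ∑ i ∈ Finset.Icc 1 q₁,
      (starRingEnd ℂ) (χ₂ (j : ZMod q₂) * χ₁ (i : ZMod q₁)) *
        (bernoulliB1 ((j : ℚ) / ((γ 1 0).natAbs : ℚ)) : ℂ) *
        (bernoulliB1 ((i : ℚ) / (q₁ : ℚ) + (γ 0 0 : ℚ) * (j : ℚ) / (γ 1 0 : ℚ)) : ℂ) =
      ∑ i ∈ Finset.range q₁, (starRingEnd ℂ) (χ₂ (j : ZMod q₂) * χ₁ (i : ZMod q₁)) *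
        ((bernoulliB1 (j / (q₂ * c : ℕ)) *
          bernoulliB1 (a * (j / (q₂ * c : ℕ)) + i / q₁) : ℚ) : ℂ) := by
    intro j
    have h0 : χ₁ 0 = 0 := by simpa using χ₁.natCast_zero_eq hq₁
    rw [sum_Icc_one_eq_sum_range _ _ (by simp [h0])]
    refine Finset.sum_congr rfl fun i _ => ?_
    rw [hslope, hc, add_comm (i / q₁ : ℚ)]
    push_cast
    ring
  rw [dedekindSum, Finset.sum_congr rfl fun j _ => hi j, hc, sum_Icc_one_eq_sum_range,
    sum_range_mul_eq]
  · refine Finset.sum_congr rfl fun r _ => ?_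
    rw [Finset.sum_comm]
    refine Finset.sum_congr rfl fun i _ => ?_
    rw [rademacherSum, Rat.cast_sum, Finset.mul_sum]
    refine Finset.sum_congr rfl fun k hk => ?_
    have hc' : (c : ℚ) ≠ 0 := by
      have := Finset.mem_range.1 hk
      exact_mod_cast (by omega : c ≠ 0)
    have h1 : ((q₂ * k + r : ℕ) / (q₂ * c : ℕ) : ℚ) = (k + r / q₂) / c := by
      push_cast
      field_simp
    rw [h1]
    simp
  · -- both end terms vanish, since `χ₂ 0 = 0`
    have h0 : χ₂ 0 = 0 := by simpa using χ₂.natCast_zero_eq hq₂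
    simp [h0]

theorem isCoprime_firstColumn {γ : SL(2, ℤ)} {q c : ℕ} {a : ℤ} (hc : (γ 1 0).natAbs = q * c)
    (ha : a = if γ 1 0 < 0 then -γ 0 0 else γ 0 0) : IsCoprime a c := by
  have hdet := γ.det_coe
  rw [Matrix.det_fin_two] at hdet
  have h1 : IsCoprime (γ 0 0) (γ 1 0) := ⟨γ 1 1, -γ 0 1, by linarith⟩
  have h2 : IsCoprime a (γ 1 0) := by
    rw [ha]
    split_ifs
    · exact h1.neg_left
    · exact h1
  refine h2.of_isCoprime_of_dvd_right ?_
  rw [← Int.dvd_natAbs, hc]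
  exact ⟨q, by push_cast; ring⟩

/-- The Dedekind sum in terms of the integers `euclidValue`. All other contributions to
`rademacherSum a c (i / q₁) (r / q₂)` are independent of `i` and vanish on summing `χ₁` over `i`. -/
theorem dedekindSum_eq_sum_euclidValue {q₁ q₂ : ℕ} (hq₁ : 1 < q₁) (hq₂ : 1 < q₂)
    {χ₁ : DirichletCharacter ℂ q₁} (hχ₁ : χ₁.IsPrimitive) (χ₂ : DirichletCharacter ℂ q₂)
    {γ : SL(2, ℤ)} (hγ : γ ∈ CongruenceSubgroup.Gamma0 (q₁ * q₂)) :
    dedekindSum χ₁ χ₂ γ = ∑ r ∈ Finset.range q₂, ∑ i ∈ Finset.range q₁,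
      (euclidValue (q₁ * q₂) (if γ 1 0 < 0 then -γ 0 0 else γ 0 0) ((γ 1 0).natAbs / q₂)
        (i * q₂) (r * q₁) : ℂ) *
      ((starRingEnd ℂ) (χ₂ (r : ZMod q₂) * χ₁ (i : ZMod q₁)) * (12 * ((q₁ : ℂ) * q₂) ^ 2)⁻¹) := by
  have hq₁' : (q₁ : ℚ) ≠ 0 := by positivity
  have hq₂' : (q₂ : ℚ) ≠ 0 := by positivity
  obtain ⟨m, hm⟩ : q₁ * q₂ ∣ (γ 1 0).natAbs := by
    rw [CongruenceSubgroup.Gamma0_mem, ZMod.intCast_zmod_eq_zero_iff_dvd] at hγ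
    exact Int.natCast_dvd.1 hγ
  set c := q₁ * m with hcdef
  have hc : (γ 1 0).natAbs = q₂ * c := by rw [hm, hcdef]; ring
  have hcdiv : (γ 1 0).natAbs / q₂ = c := by rw [hc, Nat.mul_div_cancel_left _ (by omega)]
  rw [hcdiv]
  obtain ⟨a, ha⟩ : ∃ a, a = if γ 1 0 < 0 then -γ 0 0 else γ 0 0 := ⟨_, rfl⟩
  rw [← ha, dedekindSum_eq_sum_rademacherSum hq₁ hq₂ χ₁ χ₂ hc ha]
  obtain ⟨D, hD⟩ := exists_reducedSum_eq (q₁ * q₂ : ℤ) c a (isCoprime_firstColumn hc ha)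
  -- `c` is divisible by `q₁`, so `ay + cx` with `x = i / q₁`, `y = r / q₂` is independent of `i`
  -- modulo `1`; here `G r` collects the terms in `B₂(ay)` and `B₂(y)`
  set G : ℕ → ℚ := fun r => D * bernoulliB2 (a * (r / q₂)) + a / c * bernoulliB2 (r / q₂) / 2
    with hG
  refine Finset.sum_congr rfl fun r hr => ?_
  have hrad : ∀ i ∈ Finset.range q₁, χ₁ (i : ZMod q₁) ≠ 0 →
      rademacherSum a c (i / q₁) (r / q₂) =
        euclidValue (q₁ * q₂) a c (i * q₂) (r * q₁) / (12 * (q₁ * q₂) ^ 2) + G r := by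
    intro i hi hχ
    rw [Finset.mem_range] at hi hr
    have hi0 : i ≠ 0 := by
      rintro rfl
      exact hχ (χ₁.natCast_zero_eq hq₁)
    have h1 := hD (i * q₂) (r * q₁) (by positivity) (by gcongr) (by positivity)
      (by rw [mul_comm (q₁ : ℤ)]; gcongr) (by rintro ⟨h, -⟩; norm_cast at h; simp [hi0] at h; omega)
    have e1 : (((i * q₂ : ℤ) : ℚ) / ((q₁ * q₂ : ℤ) : ℚ)) = i / q₁ := by
      push_cast; field_simp
    have e2 : (((r * q₁ : ℤ) : ℚ) / ((q₁ * q₂ : ℤ) : ℚ)) = r / q₂ := by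
      push_cast; field_simp
    have e3 : bernoulliB2 (a * (r / q₂) + c * (i / q₁)) = bernoulliB2 (a * (r / q₂)) := by
      refine bernoulliB2_periodic.eq_of_sub_eq_intCast (m * i) ?_
      rw [hcdef]
      push_cast
      field_simp
      ring
    rw [e1, e2, e3, reducedSum] at h1
    push_cast at h1
    rw [hG]
    linear_combination h1
  have hterm : ∀ i ∈ Finset.range q₁, (starRingEnd ℂ) (χ₂ (r : ZMod q₂) * χ₁ (i : ZMod q₁)) *
      (rademacherSum a c (i / q₁) (r / q₂) : ℂ) =
      (euclidValue (q₁ * q₂) a c (i * q₂) (r * q₁) : ℂ) *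
        ((starRingEnd ℂ) (χ₂ (r : ZMod q₂) * χ₁ (i : ZMod q₁)) * (12 * ((q₁ : ℂ) * q₂) ^ 2)⁻¹) +
      (starRingEnd ℂ) (χ₁ (i : ZMod q₁)) * ((starRingEnd ℂ) (χ₂ (r : ZMod q₂)) * (G r : ℂ)) := by
    intro i hi
    by_cases hχ : χ₁ (i : ZMod q₁) = 0
    · simp [hχ]
    · rw [hrad i hi hχ, map_mul]
      push_cast
      ring
  rw [Finset.sum_congr rfl hterm, Finset.sum_add_distrib, ← Finset.sum_mul, ← map_sum,
    DirichletCharacter.sum_range_eq_zero hq₁ hχ₁, map_zero, zero_mul, add_zero]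

/-! ### The time bound -/

/-- A number of steps of order `log₂ n` is `O(log n)`, where `n ≥ 2` takes care of the constant
term. -/
theorem steps_le_mul_log {L n t : ℕ} (ht : t ≤ L * (35 * (Nat.log 2 (n * n) + 3)) + 1) :
    (2 ≤ n → (t : ℝ) ≤ (175 * L + 1) / Real.log 2 * Real.log n) ∧
      (n = 0 → (t : ℝ) ≤ (175 * L + 1) / Real.log 2) := by
  have hlog2 : 0 < Real.log 2 := Real.log_pos one_lt_two
  have ht' : (t : ℝ) ≤ L * (35 * ((Nat.log 2 (n * n) : ℕ) + 3)) + 1 := by exact_mod_cast ht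
  constructor
  · intro hn
    have hn0 : (0 : ℝ) < n := by positivity
    have h1 : 1 ≤ Real.log n / Real.log 2 := by
      rw [one_le_div hlog2]
      exact Real.log_le_log two_pos (by exact_mod_cast hn)
    have h2 : ((Nat.log 2 (n * n) : ℕ) : ℝ) ≤ 2 * (Real.log n / Real.log 2) := by
      refine (Real.natLog_le_logb _ _).trans_eq ?_
      push_cast
      rw [Real.logb, Real.log_mul hn0.ne' hn0.ne']
      ring
    rw [div_mul_eq_mul_div, mul_div_assoc]
    generalize Real.log n / Real.log 2 = x at *
    have hL : (0 : ℝ) ≤ L := Nat.cast_nonneg L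
    calc (t : ℝ) ≤ L * (35 * (2 * x + 3 * x)) + x := by
          refine ht'.trans ?_
          gcongr
          linarith
      _ = (175 * L + 1) * x := by ring
  · rintro rfl
    have h3 : Real.log 2 ≤ 1 := by
      have := Real.log_le_sub_one_of_pos (x := 2) two_pos
      linarith
    rw [le_div_iff₀ hlog2]
    have hL : (0 : ℝ) ≤ L := Nat.cast_nonneg L
    simp only [mul_zero, Nat.log_zero_right, Nat.cast_zero, zero_add] at ht'
    have ht0 : (0 : ℝ) ≤ t := Nat.cast_nonneg t
    nlinarith

theorem theorem1 (q₁ q₂ : ℕ) (hq₁ : 1 < q₁) (hq₂ : 1 < q₂) :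
    ∃ C : ℝ, ∀ (χ₁ : DirichletCharacter ℂ q₁) (χ₂ : DirichletCharacter ℂ q₂),
      χ₁.IsPrimitive → χ₂.IsPrimitive → χ₁ (-1) * χ₂ (-1) = 1 →
      ∃ P : MachineProgram (dedekindField q₁ q₂),
        ∀ γ : SL(2, ℤ), γ ∈ CongruenceSubgroup.Gamma0 (q₁ * q₂) →
          ∃ (t : ℕ) (s : MachineState (dedekindField q₁ q₂)),
            P.Runs (MachineState.init γ) t s ∧
            (s.cyc 0 : ℂ) = dedekindSum χ₁ χ₂ γ ∧
            (γ 1 0 ≠ 0 → (t : ℝ) ≤ C * Real.log |(γ 1 0 : ℝ)|) ∧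
            (γ 1 0 = 0 → (t : ℝ) ≤ C) := by
  refine ⟨(175 * (q₂ * q₁ : ℕ) + 1) / Real.log 2, fun χ₁ χ₂ hχ₁ _ _ => ?_⟩
  -- the weight of the pair `(r, i)`, including the denominator of the Dedekind–Rademacher sums
  let w : ℕ × ℕ → dedekindField q₁ q₂ := fun p =>
    ⟨(starRingEnd ℂ) (χ₂ (p.1 : ZMod q₂) * χ₁ (p.2 : ZMod q₁)),
      star_mul_mem_dedekindField (by omega) (by omega) χ₁ χ₂ _ _⟩ *
        (12 * ((q₁ : dedekindField q₁ q₂) * q₂) ^ 2)⁻¹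
  let P : ℕ × ℕ → MachineProgram (dedekindField q₁ q₂) := fun p =>
    .termProgram (q₁ * q₂) q₂ (p.2 * q₂) (p.1 * q₁) (w p)
  let pairs := Finset.range q₂ ×ˢ Finset.range q₁
  refine ⟨.sequence (pairs.toList.map P), fun γ hγ => ?_⟩
  set n := (γ 1 0).natAbs with hn
  let f : ℕ × ℕ → dedekindField q₁ q₂ := fun p => euclidValue (q₁ * q₂)
    (if γ 1 0 < 0 then -γ 0 0 else γ 0 0) (n / q₂) (p.2 * q₂) (p.1 * q₁) * w p
  obtain ⟨t, s, hrun, hs, ht⟩ := MachineProgram.runs_sequence P f γ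
    (35 * (Nat.log 2 (n * n) + 3)) (fun p s hs => by
      have h := MachineProgram.runs_termProgram (q₁ * q₂) q₂ (p.2 * q₂) (p.1 * q₁) (w p) s
      rwa [hs] at h) pairs.toList (MachineState.init γ)
    (by simp [MachineState.init])
  rw [Finset.length_toList, Finset.card_product, Finset.card_range, Finset.card_range] at ht
  obtain ⟨ht₁, ht₂⟩ := steps_le_mul_log ht
  refine ⟨t, s, hrun, ?_, fun hc => ?_, fun hc => ht₂ (by rw [hn, hc, Int.natAbs_zero])⟩
  · rw [hs, Finset.sum_map_toList, Finset.sum_product,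
      dedekindSum_eq_sum_euclidValue hq₁ hq₂ hχ₁ χ₂ hγ]
    have h12 : ((12 : dedekindField q₁ q₂) : ℂ) = 12 := rfl
    simp [MachineState.init, w, hn, h12]
  · rw [← Int.cast_abs, ← Nat.cast_natAbs]
    refine ht₁ ?_
    have h1 : q₁ * q₂ ∣ n := by
      rw [CongruenceSubgroup.Gamma0_mem, ZMod.intCast_zmod_eq_zero_iff_dvd] at hγ
      exact Int.natCast_dvd.1 hγ
    have h2 := Nat.le_of_dvd (Int.natAbs_pos.2 hc) h1
    nlinarith
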